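/- Complex manifolds are Hausdorff, second countable, of pure finite dimension $n$ (not necessarily connected); "univalent" means holomorphic and injective. Let $M$ be a complex manifold of dimension $n$. An algebraic evolution family on $M$ is a family $(\varphi_{s,t})_{0\le s\le t}$ of univalent self-maps of $M$ with $\varphi_{s,s}=\mathrm{id}$ and $\varphi_{s,t}=\varphi_{u,t}\circ\varphi_{s,u}$ for $0\le s\le u\le t$. For a complex manifold $N$ of dimension $n$, a subordination chain is a family $(f_t\colon M\to N)_{t\ge 0}$ of holomorphic maps such that for all $0\le s\le t$ there is a holomorphic $v_{s,t}\colon M\to M$ with $f_s=f_t\circ v_{s,t}$; it is associated with $(\varphi_{s,t})$ if $f_s=f_t\circ\varphi_{s,t}$ for all $0\le s\le t$; it is an algebraic Loewner chain if every $f_t$ is univalent. Put $\mathrm{rg}(f_t)=\bigcup_{t\ge 0}f_t(M)$. **Theorem.** Let $(\varphi_{s,t})$ be an algebraic evolution family on $M$. 1. There is an algebraic Loewner chain associated with $(\varphi_{s,t})$. More precisely, let $(x,s)\sim(y,t)$ on $M\times\mathbb{R}^+$ mean that $\varphi_{s,u}(x)=\varphi_{t,u}(y)$ for all sufficiently large $u$,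 and let $N_0=(M\times\mathbb{R}^+)/{\sim}$ carry the quotient topology, $\mathbb{R}^+=[0,\infty)$ being discrete. Then $N_0$ is Hausdorff and second countable, is connected if $M$ is, and has a structure of complex manifold of dimension $n$ for which the maps $z\mapsto[(z,t)]$, $t\ge 0$, form an algebraic Loewner chain associated with $(\varphi_{s,t})$ with range $N_0$. 2. Let $(f_t\colon M\to N)$ be any algebraic Loewner chain associated with $(\varphi_{s,t})$. Then $\mathrm{rg}(f_t)$ is open in $N$, and for every subordination chain $(g_t\colon M\to Q)$ associated with $(\varphi_{s,t})$ there is a holomorphic map $\Lambda\colon\mathrm{rg}(f_t)\to Q$ such that $g_t=\Lambda\circ f_t$ for all $t\ge 0$. The map $\Lambda$ is univalent if and only if $(g_t)$ is an algebraic Loewner chain, and in that case $\mathrm{rg}(g_t)=\Lambda(\mathrm{rg}(f_t))$. -/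

import Mathlib

open scoped Manifold ContDiff NNReal

universe u v w

/-- A map between two complex manifolds of dimension `n` is holomorphic if it is complex analytic
when read in charts (an atlas modelled on `ℂⁿ`; `ω` is analyticity over the base field `ℂ`). -/
def IsHolomorphic (n : ℕ) {M : Type u} {N : Type v}
    [TopologicalSpace M] [ChartedSpace (EuclideanSpace ℂ (Fin n)) M]
    [TopologicalSpace N] [ChartedSpace (EuclideanSpace ℂ (Fin n)) N] (f : M → N) : Prop :=
  ContMDiff 𝓘(ℂ, EuclideanSpace ℂ (Fin n)) 𝓘(ℂ, EuclideanSpace ℂ (Fin n)) ω f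

/-- Univalent: holomorphic and injective. -/
def IsUnivalent (n : ℕ) {M : Type u} {N : Type v}
    [TopologicalSpace M] [ChartedSpace (EuclideanSpace ℂ (Fin n)) M]
    [TopologicalSpace N] [ChartedSpace (EuclideanSpace ℂ (Fin n)) N] (f : M → N) : Prop :=
  IsHolomorphic n f ∧ Function.Injective f

/-- An algebraic evolution family: univalent self-maps `φ s t` (`0 ≤ s ≤ t`) with
`φ s s = id` and `φ s t = φ u t ∘ φ s u` for `s ≤ u ≤ t`. The values `φ s t` with `t < s` carry no
meaning and are not constrained. -/
structure IsAlgebraicEvolutionFamily (n : ℕ) {M : Type u}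
    [TopologicalSpace M] [ChartedSpace (EuclideanSpace ℂ (Fin n)) M]
    (φ : ℝ≥0 → ℝ≥0 → M → M) : Prop where
  univalent : ∀ s t, s ≤ t → IsUnivalent n (φ s t)
  refl : ∀ s, φ s s = id
  comp : ∀ s u t, s ≤ u → u ≤ t → φ s t = φ u t ∘ φ s u

/-- A subordination chain: holomorphic maps `f t : M → N` such that for all `s ≤ t` one has
`f s = f t ∘ v` for some holomorphic `v : M → M`. -/
structure IsSubordinationChain (n : ℕ) {M : Type u} {N : Type v}
    [TopologicalSpace M] [ChartedSpace (EuclideanSpace ℂ (Fin n)) M]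
    [TopologicalSpace N] [ChartedSpace (EuclideanSpace ℂ (Fin n)) N]
    (f : ℝ≥0 → M → N) : Prop where
  holomorphic : ∀ t, IsHolomorphic n (f t)
  subordinate : ∀ s t, s ≤ t → ∃ v : M → M, IsHolomorphic n v ∧ f s = f t ∘ v

/-- An algebraic Loewner chain: a subordination chain of univalent maps. -/
structure IsAlgebraicLoewnerChain (n : ℕ) {M : Type u} {N : Type v}
    [TopologicalSpace M] [ChartedSpace (EuclideanSpace ℂ (Fin n)) M]
    [TopologicalSpace N] [ChartedSpace (EuclideanSpace ℂ (Fin n)) N]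
    (f : ℝ≥0 → M → N) : Prop extends IsSubordinationChain n f where
  univalent : ∀ t, IsUnivalent n (f t)

/-- The chain `f` and the evolution family `φ` are associated: `f s = f t ∘ φ s t` for `s ≤ t`. -/
def IsAssociated {M : Type u} {N : Type v} (f : ℝ≥0 → M → N) (φ : ℝ≥0 → ℝ≥0 → M → M) : Prop :=
  ∀ s t, s ≤ t → f s = f t ∘ φ s t

/-- The range of a chain, `⋃ t, f t (M)`. -/
def chainRange {M : Type u} {N : Type v} (f : ℝ≥0 → M → N) : Set N :=
  ⋃ t, Set.range (f t)

/-- Every value of the chain lies in its range. -/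
theorem mem_chainRange {M : Type u} {N : Type v} (f : ℝ≥0 → M → N) (t : ℝ≥0) (z : M) :
    f t z ∈ chainRange f :=
  Set.mem_iUnion.2 ⟨t, z, rfl⟩

/-- The relation on `M × ℝ⁺`: `(x, s) ∼ (y, t)` iff `φ s u x = φ t u y` for all large `u`. -/
def evolutionSetoid {M : Type u} (φ : ℝ≥0 → ℝ≥0 → M → M) : Setoid (M × ℝ≥0) where
  r p q := ∀ᶠ u in Filter.atTop, φ p.2 u p.1 = φ q.2 u q.1
  iseqv :=
    { refl := fun _ => Filter.Eventually.of_forall fun _ => rfl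
      symm := fun h => h.mono fun _ hu => hu.symm
      trans := fun h₁ h₂ => (h₁.and h₂).mono fun _ hu => hu.1.trans hu.2 }

/-- The quotient `(M × ℝ⁺) / ∼`. -/
def EvolutionQuotient {M : Type u} (φ : ℝ≥0 → ℝ≥0 → M → M) : Type u :=
  Quotient (evolutionSetoid φ)

/-- The quotient topology, where `M × ℝ⁺` has the product topology with `ℝ⁺` discrete. -/
instance EvolutionQuotient.topologicalSpace {M : Type u} [TopologicalSpace M]
    (φ : ℝ≥0 → ℝ≥0 → M → M) : TopologicalSpace (EvolutionQuotient φ) :=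
  TopologicalSpace.coinduced (Quotient.mk (evolutionSetoid φ))
    (@instTopologicalSpaceProd M ℝ≥0 _ ⊥)

/-- The canonical maps `z ↦ [(z, t)]` from `M` to the quotient. -/
def EvolutionQuotient.chain {M : Type u} (φ : ℝ≥0 → ℝ≥0 → M → M) (t : ℝ≥0) (z : M) :
    EvolutionQuotient φ :=
  Quotient.mk (evolutionSetoid φ) (z, t)

/-! The argument is formal once univalent maps between manifolds of equal dimension are known to be
open with holomorphic local inverses. This rests on Osgood's theorem,
`AnalyticAt.injective_fderiv_of_injOn`, proved by induction on the dimension. Where the derivative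
is nonzero, one scalar component of `f` can be straightened; `f` then restricts to an injective map
between hyperplanes, and the lower-dimensional case applies. So near `p` the derivative is either
zero or injective, and it vanishes exactly on the zero set of one analytic function, its
determinant. In dimension at least two a zero is impossible: near a suitable point the zero set
would be a smooth hypersurface, by a Hurwitz argument, and `f` would be constant along curves in it.

The quotient is an increasing union of copies of `M`, glued along the maps `φ s t`. Their
injectivity allows equivalence to be tested at any common time
(`IsAlgebraicEvolutionFamily.chain_eq_iff`); their openness makes each copy an open subset
(`IsAlgebraicEvolutionFamily.isOpenEmbedding_chain`), so charts carry over. Any two points lie in a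
common copy, which gives the Hausdorff property.

For universality, `g t ∘ (f t)⁻¹` does not depend on `t` (`IsAssociated.eq_of_eq`), and it is
holomorphic because `f t` has holomorphic local inverses. -/

section OsgoodAndQuotient

open Filter Topology Set

/-! ### Injective functions of one variable -/

/-- An injective holomorphic function of one variable has nonvanishing derivative. -/
theorem AnalyticAt.deriv_ne_zero_of_injOn {f : ℂ → ℂ} {p : ℂ} (hf : AnalyticAt ℂ f p)
    {U : Set ℂ} (hU : U ∈ 𝓝 p) (hinj : InjOn f U) : deriv f p ≠ 0 := by
  -- Zeros of the derivative are isolated, since otherwise `f` is constant near `p`.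
  have hnc : ∀ᶠ z in 𝓝[≠] p, deriv f z ≠ 0 := by
    refine hf.deriv.eventually_eq_zero_or_eventually_ne_zero.resolve_left fun h0 => ?_
    obtain ⟨r, hr, hB⟩ := Metric.eventually_nhds_iff_ball.1
      ((h0.and hf.eventually_analyticAt).and hU)
    have hne : (p + (r / 2 : ℝ) : ℂ) ∈ Metric.ball p r := by
      simp [abs_of_pos hr, hr]
    have := Metric.isOpen_ball.is_const_of_deriv_eq_zero (convex_ball p r).isPreconnected
      (fun z hz => (hB z hz).1.2.differentiableAt.differentiableWithinAt)
      (fun z hz => (hB z hz).1.1) hne (Metric.mem_ball_self hr)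
    have := hinj (hB _ hne).2 (mem_of_mem_nhds hU) this
    simp [hr.ne'] at this
  obtain ⟨r, hr, hB⟩ := Metric.eventually_nhds_iff_ball.1
    ((eventually_nhdsWithin_iff.1 hnc |>.and hf.eventually_analyticAt).and hU)
  set B := Metric.ball p r
  have hinjB : InjOn f B := hinj.mono fun z hz => (hB z hz).2
  have hfB : AnalyticOnNhd ℂ f B := fun z hz => (hB z hz).1.2
  have hopen : ∀ s ⊆ B, IsOpen s → IsOpen (f '' s) := by
    refine (hfB.is_constant_or_isOpen (convex_ball p r).isPreconnected).resolve_left ?_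
    rintro ⟨w, hw⟩
    have hne : (p + (r / 2 : ℝ) : ℂ) ∈ B := by simp [B, abs_of_pos hr, hr]
    have := hinjB hne (Metric.mem_ball_self hr)
      ((hw _ hne).trans (hw _ (Metric.mem_ball_self hr)).symm)
    simp [hr.ne'] at this
  have hBo : IsOpen B := Metric.isOpen_ball
  have hpB : p ∈ B := Metric.mem_ball_self hr
  set g := Function.invFunOn f B
  have hg : ∀ z ∈ B, g (f z) = z := fun z hz => hinjB.leftInvOn_invFunOn hz
  have hcont : ∀ z ∈ B, ContinuousAt g (f z) := by
    intro z hz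
    rw [ContinuousAt, hg z hz]
    intro s hs
    obtain ⟨t, hts, ht, hzt⟩ := mem_nhds_iff.1 (inter_mem hs (hBo.mem_nhds hz))
    refine mem_map.2
      (mem_of_superset ((hopen t (fun x hx => (hts hx).2) ht).mem_nhds ⟨z, hzt, rfl⟩) ?_)
    rintro _ ⟨x, hx, rfl⟩
    rw [mem_preimage, hg x (hts hx).2]
    exact (hts hx).1
  have hfg : ∀ z ∈ B, ∀ᶠ y in 𝓝 (f z), f (g y) = y := by
    intro z hz
    refine mem_of_superset ((hopen B subset_rfl hBo).mem_nhds ⟨z, hz, rfl⟩) ?_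
    rintro _ ⟨x, hx, rfl⟩
    simp only [mem_ofPred_eq, hg x hx]
  have hdiff : DifferentiableOn ℂ g (f '' B \ {f p}) := by
    rintro _ ⟨⟨z, hz, rfl⟩, hzp⟩
    have hzp' : z ≠ p := fun h => hzp (by simp [h])
    have hd : HasDerivAt f (deriv f z) (g (f z)) := by
      rw [hg z hz]; exact (hfB z hz).differentiableAt.hasDerivAt
    exact (HasDerivAt.of_local_left_inverse (hcont z hz) hd
      ((hB z hz).1.1 hzp') (hfg z hz)).differentiableAt.differentiableWithinAt
  -- The inverse is continuous at `f p` and differentiable at the other points of the image, so the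
  -- singularity is removable; the chain rule for `g ∘ f = id` then excludes a zero derivative.
  have hgd : DifferentiableAt ℂ g (f p) :=
    ((Complex.differentiableOn_compl_singleton_and_continuousAt_iff
      ((hopen B subset_rfl hBo).mem_nhds ⟨p, hpB, rfl⟩)).1 ⟨hdiff, hcont p hpB⟩).differentiableAt
      ((hopen B subset_rfl hBo).mem_nhds ⟨p, hpB, rfl⟩)
  have hid : HasDerivAt (g ∘ f) (deriv g (f p) * deriv f p) p :=
    hgd.hasDerivAt.comp p hf.differentiableAt.hasDerivAt
  have hid' : HasDerivAt (g ∘ f) 1 p :=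
    (hasDerivAt_id p).congr_of_eventuallyEq (by
      filter_upwards [hBo.mem_nhds hpB] with z hz using hg z hz)
  intro h
  simpa [h] using hid.unique hid'

/-! ### Zero sets of analytic functions and local inverses -/

section

variable {E : Type u} [NormedAddCommGroup E] [NormedSpace ℂ E]
  {F : Type v} [NormedAddCommGroup F] [NormedSpace ℂ F]

/-- An analytic function vanishes near a point if all its iterated derivatives vanish there. -/
theorem AnalyticAt.eventually_eq_zero_of_iteratedFDeriv [CompleteSpace F] {h : E → F} {p : E}
    (hh : AnalyticAt ℂ h p) (h0 : ∀ k, iteratedFDeriv ℂ k h p = 0) : ∀ᶠ z in 𝓝 p, h z = 0 := by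
  obtain ⟨P, r, hP⟩ := hh
  filter_upwards [Metric.eball_mem_nhds p hP.r_pos] with z hz
  have hz' : z - p ∈ Metric.eball (0 : E) r := by
    simpa [edist_eq_enorm_sub] using hz
  have := hP.hasSum_iteratedFDeriv hz'
  simpa [h0] using this.unique (by simp [h0, hasSum_zero])

/-- The zero set of a nonzero scalar analytic function is contained, near one of its points, in a
smooth hypersurface. -/
theorem AnalyticOnNhd.exists_fderiv_ne_zero_of_zeros {h : E → ℂ} {B : Set E}
    (hh : AnalyticOnNhd ℂ h B) {p : E} (hp : p ∈ B) (hp0 : h p = 0)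
    (hne : ¬ ∀ᶠ z in 𝓝 p, h z = 0) :
    ∃ q ∈ B, h q = 0 ∧ ∃ g : E → ℂ, AnalyticOnNhd ℂ g B ∧ (∀ z ∈ B, h z = 0 → g z = 0) ∧
      fderiv ℂ g q ≠ 0 := by
  by_contra! hcon
  refine hne ((hh p hp).eventually_eq_zero_of_iteratedFDeriv fun k => ?_)
  -- By `hcon`, any analytic function vanishing on the zeros of `h` has zero derivative there;
  -- applied to the coefficients of the `k`-th derivative, this gives the next order.
  have key : ∀ k, ∀ q ∈ B, h q = 0 → iteratedFDeriv ℂ k h q = 0 := by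
    intro k
    induction k with
    | zero => intro q _ hq0; ext; simp [hq0]
    | succ k ih =>
      intro q hq hq0
      have hk : AnalyticOnNhd ℂ (iteratedFDeriv ℂ k h) B := hh.iteratedFDeriv k
      ext m
      rw [iteratedFDeriv_succ_apply_left]
      let L : ContinuousMultilinearMap ℂ (fun _ : Fin k => E) ℂ →L[ℂ] ℂ :=
        ContinuousMultilinearMap.apply ℂ (fun _ : Fin k => E) ℂ (Fin.tail m)
      have hL := hcon q hq hq0 (fun z => L (iteratedFDeriv ℂ k h z))
        (fun z hz => (L.analyticAt _).comp (hk z hz))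
        (fun z hz hz0 => by simp [ih z hz hz0])
      have hcomp := (L.hasFDerivAt.comp q (hk q hq).differentiableAt.hasFDerivAt).fderiv
      have : (L ∘L fderiv ℂ (iteratedFDeriv ℂ k h) q) (m 0) = 0 := by
        rw [← hcomp]
        exact DFunLike.congr_fun hL (m 0)
      simpa [L] using this
  exact key k p hp hp0

/-- A consequence of Hurwitz's theorem: if the zeros of `h` near `p` lie in the hyperplane
`lam = 0` and `h p = 0`, then `h` vanishes on this hyperplane near `p`. -/
theorem AnalyticAt.eventually_eq_zero_of_zeros_subset_ker [CompleteSpace E] {h : E → ℂ} {p : E}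
    (hh : AnalyticAt ℂ h p)
    {lam : E →L[ℂ] ℂ} {e : E} (he : lam e = 1) (hp : lam p = 0) (hp0 : h p = 0)
    (hz : ∀ᶠ z in 𝓝 p, h z = 0 → lam z = 0) : ∀ᶠ z in 𝓝 p, lam z = 0 → h z = 0 := by
  have hcl : Tendsto (fun x : E × ℂ => x.1 + x.2 • e) (𝓝 (p, 0)) (𝓝 p) := by
    have : Continuous (fun x : E × ℂ => x.1 + x.2 • e) := by fun_prop
    simpa using this.tendsto (p, 0)
  obtain ⟨⟨ρ, r⟩, ⟨hρ, hr⟩, hgood⟩ :=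
    ((Metric.nhds_basis_ball.prod_nhds Metric.nhds_basis_ball).eventually_iff).1
      (hcl.eventually (hz.and hh.eventually_analyticAt))
  simp only [mem_prod, and_imp, Prod.forall] at hρ hr hgood
  have hlam : ∀ x ζ, lam x = 0 → lam (x + ζ • e) = ζ := by
    intro x ζ hx
    simp [hx, he]
  set s := r / 2 with hs
  have hs0 : 0 < s := half_pos hr
  have hsr : ∀ ζ ∈ Metric.closedBall (0 : ℂ) s, ζ ∈ Metric.ball (0 : ℂ) r := fun ζ hζ =>
    Metric.closedBall_subset_ball (half_lt_self hr) hζ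
  have hpρ : p ∈ Metric.ball p ρ := Metric.mem_ball_self hρ
  have hana : ∀ x ∈ Metric.ball p ρ, ∀ ζ ∈ Metric.ball (0 : ℂ) r,
      DifferentiableAt ℂ (fun ζ : ℂ => h (x + ζ • e)) ζ := by
    intro x hx ζ hζ
    exact (hgood x ζ hx hζ).2.differentiableAt.comp ζ (by fun_prop)
  -- On the line through `p` in direction `e`, `h` can vanish only at `ζ = 0`, so `‖h‖` has a
  -- positive lower bound on the circle.
  obtain ⟨m, hm, hmin⟩ := (isCompact_sphere (0 : ℂ) s).exists_forall_le'
    (f := fun ζ : ℂ => ‖h (p + ζ • e)‖) (a := 0)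
    (fun ζ hζ => (hana p hpρ ζ
      (hsr ζ (Metric.sphere_subset_closedBall hζ))).continuousAt.norm.continuousWithinAt)
    (by
      intro ζ hζ
      rw [norm_pos_iff]
      intro h0
      have := (hgood p ζ hpρ (hsr ζ (Metric.sphere_subset_closedBall hζ))).1 h0
      rw [hlam p ζ hp] at this
      simp [this] at hζ
      exact hs0.ne hζ)
  have hcircle : ∀ᶠ x in 𝓝 p, ∀ ζ ∈ Metric.sphere (0 : ℂ) s, m / 2 < ‖h (x + ζ • e)‖ := by
    refine (isCompact_sphere (0 : ℂ) s).eventually_forall_of_forall_eventually fun ζ hζ => ?_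
    have hc : ContinuousAt (fun z : E × ℂ => ‖h (z.1 + z.2 • e)‖) (p, ζ) := by
      refine ContinuousAt.norm (ContinuousAt.comp (g := h) ?_ (by fun_prop))
      exact (hgood p ζ hpρ (hsr ζ (Metric.sphere_subset_closedBall hζ))).2.continuousAt
    exact hc.eventually (lt_mem_nhds ((half_lt_self hm).trans_le (hmin ζ hζ)))
  have hsmall : ∀ᶠ x in 𝓝 p, ‖h x‖ < m / 2 :=
    hh.continuousAt.norm.eventually (gt_mem_nhds (by simpa [hp0] using hm))
  filter_upwards [hcircle, hsmall, Metric.ball_mem_nhds p hρ] with x hx1 hx2 hxρ hx0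
  by_contra hne
  have hnz : ∀ ζ ∈ Metric.closedBall (0 : ℂ) s, h (x + ζ • e) ≠ 0 := by
    intro ζ hζ h0
    have := (hgood x ζ hxρ (hsr ζ hζ)).1 h0
    rw [hlam x ζ hx0] at this
    exact hne (by simpa [this] using h0)
  -- If `h x ≠ 0`, the reciprocal is holomorphic on the whole disc, and the maximum principle bounds
  -- its value at the centre by `(m / 2)⁻¹`, against `hx2`.
  have hd : DiffContOnCl ℂ (fun ζ : ℂ => (h (x + ζ • e))⁻¹) (Metric.ball 0 s) := by
    refine DifferentiableOn.diffContOnCl fun ζ hζ => ?_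
    have hζ' := Metric.closure_ball_subset_closedBall hζ
    exact ((hana x hxρ ζ (hsr ζ hζ')).inv (hnz ζ hζ')).differentiableWithinAt
  have hmax := Complex.norm_le_of_forall_mem_frontier_norm_le Metric.isBounded_ball hd
    (C := (m / 2)⁻¹) (fun ζ hζ => by
      rw [frontier_ball _ hs0.ne'] at hζ
      rw [norm_inv]
      exact inv_anti₀ (half_pos hm) (hx1 ζ hζ).le) (subset_closure (Metric.mem_ball_self hs0))
  simp only [zero_smul, add_zero, norm_inv] at hmax
  exact absurd ((inv_le_inv₀ (norm_pos_iff.2 hne) (half_pos hm)).1 hmax) (not_le.2 hx2)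

/-- An analytic map with invertible derivative has an analytic local inverse. -/
theorem AnalyticAt.exists_localInverse [CompleteSpace E] [CompleteSpace F] {f : E → F} {p : E}
    (hf : AnalyticAt ℂ f p) (f' : E ≃L[ℂ] F) (hf' : HasFDerivAt f (f' : E →L[ℂ] F) p) :
    ∃ k : F → E, AnalyticAt ℂ k (f p) ∧ k (f p) = p ∧
      HasFDerivAt k (f'.symm : F →L[ℂ] E) (f p) ∧ ∀ᶠ y in 𝓝 (f p), f (k y) = y := by
  have hs : HasStrictFDerivAt f (f' : E →L[ℂ] F) p := hf'.fderiv ▸ hf.hasStrictFDerivAt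
  have hc : ContDiffAt ℂ ω f p := hf.contDiffAt
  exact ⟨hc.localInverse hf' (by simp), (hc.to_localInverse hf' (by simp)).analyticAt,
    hs.localInverse_apply_image, hs.to_localInverse.hasFDerivAt, hs.eventually_right_inverse⟩

end

/-! ### Osgood's theorem by induction on the dimension -/

section

variable {E : Type u} [NormedAddCommGroup E] [NormedSpace ℂ E]
  {F : Type v} [NormedAddCommGroup F] [NormedSpace ℂ F]

/-- Straightening of a submersion: a local analytic change of variables, tangent to the identity,
turning `g` into its differential. -/
theorem AnalyticAt.exists_straightening [CompleteSpace E] {g : E → ℂ} {p : E}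
    (hg : AnalyticAt ℂ g p) (hd : fderiv ℂ g p ≠ 0) :
    ∃ (k : E → E) (q : E), AnalyticAt ℂ k q ∧ k q = p ∧ HasFDerivAt k (.id ℂ E) q ∧
      (∀ᶠ y in 𝓝 q, g (k y) = fderiv ℂ g p y) ∧ ∃ V ∈ 𝓝 q, InjOn k V := by
  obtain ⟨e, he⟩ : ∃ e, fderiv ℂ g p e = 1 := by
    obtain ⟨x, hx⟩ := DFunLike.ne_iff.1 hd
    exact ⟨(fderiv ℂ g p x)⁻¹ • x, by simpa using inv_mul_cancel₀ hx⟩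
  set lam := fderiv ℂ g p with hlam
  -- The component of `x` along `e` is replaced by `g x`, so that `lam ∘ G = g` while the derivative
  -- of `G` at `p` is the identity.
  let G : E → E := fun x => x - lam x • e + g x • e
  have hG : AnalyticAt ℂ G p :=
    (analyticAt_id.sub ((lam.analyticAt p).smul analyticAt_const)).add (hg.smul analyticAt_const)
  have hGd : HasFDerivAt G ((ContinuousLinearEquiv.refl ℂ E : E ≃L[ℂ] E) : E →L[ℂ] E) p := by
    have := ((hasFDerivAt_id (𝕜 := ℂ) p).sub (lam.hasFDerivAt.smul_const e)).add
      (hg.differentiableAt.hasFDerivAt.smul_const e)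
    refine this.congr_fderiv ?_
    ext x
    simp [hlam]
  obtain ⟨k, hk, hkp, hkd, hright⟩ := hG.exists_localInverse _ hGd
  refine ⟨k, G p, hk, hkp, hkd, ?_, ?_⟩
  · filter_upwards [hright] with y hy
    have : lam (G (k y)) = g (k y) := by simp [G, he]
    rw [← this, hy]
  · exact ⟨_, hright, fun x hx y hy hxy => by rw [← hx.out, ← hy.out, hxy]⟩

/-- Injectivity of a nonzero derivative, from the lower-dimensional case. -/
theorem AnalyticAt.injective_fderiv_of_ne_zero {d : ℕ}
    (ih : ∀ (E : Type u) [NormedAddCommGroup E] [NormedSpace ℂ E] (F : Type v)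
      [NormedAddCommGroup F] [NormedSpace ℂ F] [FiniteDimensional ℂ E] [FiniteDimensional ℂ F],
      Module.finrank ℂ E = d → Module.finrank ℂ F = d → ∀ (f : E → F) (p : E),
      AnalyticAt ℂ f p → ∀ U ∈ 𝓝 p, InjOn f U → Function.Injective (fderiv ℂ f p))
    [FiniteDimensional ℂ E] [FiniteDimensional ℂ F]
    (hE : Module.finrank ℂ E = d + 1) (hF : Module.finrank ℂ F = d + 1) {f : E → F} {p : E}
    (hf : AnalyticAt ℂ f p) {U : Set E} (hU : U ∈ 𝓝 p) (hinj : InjOn f U)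
    (hne : fderiv ℂ f p ≠ 0) : Function.Injective (fderiv ℂ f p) := by
  have := FiniteDimensional.complete ℂ E
  have := FiniteDimensional.complete ℂ F
  set A := fderiv ℂ f p with hA
  obtain ⟨v, hv⟩ := DFunLike.ne_iff.1 hne
  obtain ⟨l, hl⟩ : ∃ l : F →L[ℂ] ℂ, l (A v) = 1 := SeparatingDual.exists_eq_one hv
  let g : E → ℂ := fun x => l (f x - f p)
  have hg : AnalyticAt ℂ g p := (l.analyticAt _).comp (hf.sub analyticAt_const)
  have hgd : fderiv ℂ g p = l ∘L A :=
    (l.hasFDerivAt.comp p (hf.differentiableAt.hasFDerivAt.sub_const _)).fderiv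
  have hgne : fderiv ℂ g p ≠ 0 := fun h => by
    have := DFunLike.congr_fun (hgd.symm.trans h) v
    simp [hl] at this
  obtain ⟨k, q, hk, hkq, hkd, hgk, V, hV, hkV⟩ := hg.exists_straightening hgne
  rw [hgd] at hgk
  have hq0 : l (A q) = 0 := by
    have := hgk.self_of_nhds
    simpa [g, hkq] using this.symm
  let lE : E →ₗ[ℂ] ℂ := (l ∘L A : E →L[ℂ] ℂ)
  let lF : F →ₗ[ℂ] ℂ := l
  let H := LinearMap.ker lE
  let K := LinearMap.ker lF
  have hEne : lE ≠ 0 := fun h => by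
    have := DFunLike.congr_fun h v
    simp [lE, hl] at this
  have hFne : lF ≠ 0 := fun h => by
    have := DFunLike.congr_fun h (A v)
    simp [lF, hl] at this
  have hH : Module.finrank ℂ H = d := by
    have := Module.Dual.finrank_ker_add_one_of_ne_zero hEne
    exact Nat.succ_injective (this.trans hE)
  have hK : Module.finrank ℂ K = d := by
    have := Module.Dual.finrank_ker_add_one_of_ne_zero hFne
    exact Nat.succ_injective (this.trans hF)
  -- The projection onto `ker l` along `A v`. On the straightened hyperplane `f ∘ k - f p` already
  -- takes values in `ker l`, so composing with `P` preserves injectivity.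
  let P : F →L[ℂ] K := (ContinuousLinearMap.id ℂ F - l.smulRight (A v)).codRestrict K (by
    intro x; simp [K, lF, hl])
  have hP : ∀ y, l y = 0 → (P y : F) = y := fun y hy => by simp [P, hy]
  let φ : H → K := fun y => P (f (k (q + y)) - f p)
  have hφa : AnalyticAt ℂ (fun y : H => f (k (q + y)) - f p) 0 := by
    have h1 : AnalyticAt ℂ (fun y : H => q + (y : E)) 0 :=
      analyticAt_const.add (H.subtypeL.analyticAt 0)
    have h2 : AnalyticAt ℂ (fun y : H => k (q + (y : E))) 0 :=
      AnalyticAt.comp (g := k) (by simpa using hk) h1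
    exact (AnalyticAt.comp (g := f) (by simpa [hkq] using hf) h2).sub analyticAt_const
  have hφ : AnalyticAt ℂ φ 0 := (P.analyticAt _).comp hφa
  have hφd : HasFDerivAt φ (P ∘L A ∘L H.subtypeL) 0 := by
    have h1 : HasFDerivAt (fun y : H => q + (y : E)) H.subtypeL 0 :=
      H.subtypeL.hasFDerivAt.const_add q
    have h2 : HasFDerivAt (fun y : H => k (q + (y : E))) H.subtypeL 0 :=
      (HasFDerivAt.comp (g := k) 0 (by simpa using hkd) h1).congr_fderiv (by ext; simp)
    have h3 : HasFDerivAt (fun y : H => f (k (q + (y : E)))) (A ∘L H.subtypeL) 0 :=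
      HasFDerivAt.comp (g := f) 0 (by simpa [hkq] using hf.differentiableAt.hasFDerivAt) h2
    exact P.hasFDerivAt.comp 0 (h3.sub_const _)
  have htend : Tendsto (fun y : H => q + (y : E)) (𝓝 0) (𝓝 q) := by
    have : Continuous (fun y : H => q + (y : E)) := by fun_prop
    simpa using this.tendsto 0
  have hkU : ∀ᶠ y in 𝓝 q, k y ∈ U := hk.continuousAt.eventually (by rwa [hkq])
  have hφinj : InjOn φ 
      {y : H | (g (k (q + y)) = (l ∘L A) (q + y) ∧ k (q + y) ∈ U) ∧ q + (y : E) ∈ V} := by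
    have hzero : ∀ y : H, g (k (q + y)) = (l ∘L A) (q + y) → (φ y : F) = f (k (q + y)) - f p := by
      intro y hy
      refine hP _ (hy.trans ?_)
      have : l (A y) = 0 := y.2
      simp [hq0, this]
    rintro x ⟨⟨hx1, hx2⟩, hx3⟩ y ⟨⟨hy1, hy2⟩, hy3⟩ hxy
    have hxy' := congrArg (Subtype.val) hxy
    rw [hzero x hx1, hzero y hy1] at hxy'
    exact Subtype.ext (add_left_cancel (hkV hx3 hy3 (hinj hx2 hy2 (sub_left_injective hxy'))))
  have hmain := ih H K hH hK φ 0 hφ _ (htend.eventually ((hgk.and hkU).and hV)) hφinj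
  rw [hφd.fderiv] at hmain
  -- The kernel of `A` lies in `H = ker (l ∘ A)`, so injectivity on `H` is enough.
  refine (injective_iff_map_eq_zero A).2 fun x hx => ?_
  have hxH : x ∈ H := by simp [H, lE, hx]
  have := (injective_iff_map_eq_zero _).1 hmain ⟨x, hxH⟩ (by simp [hx])
  exact congrArg Subtype.val this

/-- The case of dimension one. -/
theorem AnalyticAt.injective_fderiv_of_finrank_eq_one [FiniteDimensional ℂ E]
    [FiniteDimensional ℂ F] (hE : Module.finrank ℂ E = 1) (hF : Module.finrank ℂ F = 1)
    {f : E → F} {p : E}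
    (hf : AnalyticAt ℂ f p) {U : Set E} (hU : U ∈ 𝓝 p) (hinj : InjOn f U) :
    Function.Injective (fderiv ℂ f p) := by
  let a : ℂ ≃L[ℂ] E := ContinuousLinearEquiv.ofFinrankEq (by simp [hE])
  let b : F ≃L[ℂ] ℂ := ContinuousLinearEquiv.ofFinrankEq (by simp [hF])
  have hap : a (a.symm p) = p := a.apply_symm_apply p
  have hfa : AnalyticAt ℂ (fun z => f (a z)) (a.symm p) :=
    AnalyticAt.comp (g := f) (by rwa [hap]) ((a : ℂ →L[ℂ] E).analyticAt _)
  have hana : AnalyticAt ℂ (fun z => b (f (a z))) (a.symm p) :=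
    ((b : F →L[ℂ] ℂ).analyticAt _).comp hfa
  have hne := hana.deriv_ne_zero_of_injOn (U := a ⁻¹' U)
    (a.continuous.continuousAt.preimage_mem_nhds (by rwa [hap]))
    fun x hx y hy hxy => a.injective (hinj hx hy (b.injective hxy))
  have hd : HasFDerivAt (fun z => b (f (a z)))
      ((b : F →L[ℂ] ℂ) ∘L fderiv ℂ f p ∘L (a : ℂ →L[ℂ] E)) (a.symm p) := by
    refine (b : F →L[ℂ] ℂ).hasFDerivAt.comp _ (HasFDerivAt.comp (g := f) _ ?_
      (a : ℂ →L[ℂ] E).hasFDerivAt)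
    simpa [hap] using hf.differentiableAt.hasFDerivAt
  rw [hd.hasDerivAt.deriv] at hne
  refine (injective_iff_map_eq_zero _).2 fun x hx => ?_
  by_contra hx0
  apply hne
  have h1 : a 1 = (a.symm x)⁻¹ • x := by
    have hax : a.symm x ≠ 0 := by simpa using hx0
    apply a.symm.injective
    simp [hax]
  simp [h1, hx]

/-- A map whose derivative vanishes along a hyperplane is not injective. -/
theorem AnalyticAt.not_injOn_of_fderiv_eq_zero {f : E → F} {q : E} [CompleteSpace F]
    (hf : AnalyticAt ℂ f q)
    {lam : E →L[ℂ] ℂ} (hq : lam q = 0) {w : E} (hw : w ≠ 0) (hlw : lam w = 0)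
    (hev : ∀ᶠ z in 𝓝 q, lam z = 0 → fderiv ℂ f z = 0) {U : Set E} (hU : U ∈ 𝓝 q) :
    ¬ InjOn f U := by
  intro hinj
  have htend : Tendsto (fun t : ℂ => q + t • w) (𝓝 0) (𝓝 q) := by
    have : Continuous (fun t : ℂ => q + t • w) := by fun_prop
    simpa using this.tendsto 0
  obtain ⟨r, hr, hB⟩ := Metric.eventually_nhds_iff_ball.1
    (htend.eventually ((hev.and hf.eventually_analyticAt).and hU))
  have hder : ∀ t ∈ Metric.ball (0 : ℂ) r, HasDerivAt (fun t : ℂ => f (q + t • w)) 0 t := by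
    intro t ht
    have h0 : fderiv ℂ f (q + t • w) = 0 := (hB t ht).1.1 (by simp [hq, hlw])
    have h1 : HasDerivAt (fun t : ℂ => q + t • w) w t := by
      simpa using ((hasDerivAt_id t).smul_const w).const_add q
    have h2 := (hB t ht).1.2.differentiableAt.hasFDerivAt.comp_hasDerivAt t h1
    rw [h0, zero_apply] at h2
    exact h2
  have hne : ((r / 2 : ℝ) : ℂ) ∈ Metric.ball (0 : ℂ) r := by simp [abs_of_pos hr, hr]
  have h00 : (0 : ℂ) ∈ Metric.ball (0 : ℂ) r := Metric.mem_ball_self hr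
  have := Metric.isOpen_ball.is_const_of_deriv_eq_zero (convex_ball (0 : ℂ) r).isPreconnected
    (fun z hz => (hder z hz).differentiableAt.differentiableWithinAt)
    (fun z hz => (hder z hz).deriv) hne h00
  have := hinj (hB _ hne).2 (hB _ h00).2 this
  simp [hr.ne', hw] at this

/-- In dimension at least two, the derivative of an injective analytic map does not vanish,
provided that at nearby points it is either zero or injective. -/
theorem AnalyticAt.fderiv_ne_zero_of_injOn [FiniteDimensional ℂ E] [FiniteDimensional ℂ F]
    (hE : 2 ≤ Module.finrank ℂ E) (hEF : Module.finrank ℂ E = Module.finrank ℂ F)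
    {f : E → F} {p : E} (hf : AnalyticAt ℂ f p) {U : Set E} (hU : U ∈ 𝓝 p) (hinj : InjOn f U)
    (hzero : ∀ᶠ z in 𝓝 p, fderiv ℂ f z ≠ 0 → Function.Injective (fderiv ℂ f z)) :
    fderiv ℂ f p ≠ 0 := by
  have := FiniteDimensional.complete ℂ E
  have := FiniteDimensional.complete ℂ F
  have : Nontrivial E := Module.nontrivial_of_finrank_pos (R := ℂ) (by omega)
  intro hp0
  obtain ⟨r, hr, hB⟩ := Metric.eventually_nhds_iff_ball.1
    ((hzero.and hf.eventually_analyticAt).and hU)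
  set B := Metric.ball p r
  have hBo : IsOpen B := Metric.isOpen_ball
  have hfB : AnalyticOnNhd ℂ f B := fun z hz => (hB z hz).1.2
  have hinjB : InjOn f B := hinj.mono fun z hz => (hB z hz).2
  let L : F ≃L[ℂ] E := ContinuousLinearEquiv.ofFinrankEq hEF.symm
  let h : E → ℂ := fun z => LinearMap.det ((L : F →L[ℂ] E) ∘L fderiv ℂ f z : E →L[ℂ] E).toLinearMap
  have hhana : AnalyticOnNhd ℂ h B := by
    intro z hz
    let b := Module.finBasis ℂ E
    -- The Leibniz expansion shows that `h` is a polynomial in matrix entries that depend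
    -- analytically on `z`.
    have hh : h = fun z => ∑ σ : Equiv.Perm (Fin (Module.finrank ℂ E)),
        ((Equiv.Perm.sign σ : ℤ) : ℂ) * ∏ i, b.repr (L (fderiv ℂ f z (b i))) (σ i) := by
      funext z
      simp only [h]
      rw [← LinearMap.det_toMatrix b, Matrix.det_apply']
      simp [LinearMap.toMatrix_apply]
    rw [hh]
    refine Finset.analyticAt_fun_sum _ fun σ _ => analyticAt_const.mul
      (Finset.analyticAt_fun_prod _ fun i _ => ?_)
    let T : (E →L[ℂ] F) →L[ℂ] ℂ := LinearMap.toContinuousLinearMap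
      ((b.coord (σ i)).comp ((L : F →L[ℂ] E).toLinearMap)) ∘L ContinuousLinearMap.apply ℂ F (b i)
    exact (T.analyticAt _).comp (hfB z hz).fderiv
  have hh0 : ∀ z ∈ B, h z = 0 ↔ fderiv ℂ f z = 0 := by
    intro z hz
    constructor
    · intro hz0
      by_contra hne
      have hi := (hB z hz).1.1 hne
      have := LinearMap.bot_lt_ker_of_det_eq_zero hz0
      refine this.ne' (LinearMap.ker_eq_bot.2 (L.injective.comp hi))
    · intro hz0
      simp only [h, hz0, ContinuousLinearMap.comp_zero, ContinuousLinearMap.toLinearMap_zero]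
      exact LinearMap.det_zero''
  have hpB : p ∈ B := Metric.mem_ball_self hr
  have hnloc : ¬ ∀ᶠ z in 𝓝 p, h z = 0 := by
    intro hev
    obtain ⟨w, hw⟩ := exists_ne (0 : E)
    -- With `lam = 0` the hyperplane is the whole space: here the derivative vanishes on a full
    -- neighbourhood.
    refine hf.not_injOn_of_fderiv_eq_zero (lam := 0) rfl hw rfl ?_ hU hinj
    filter_upwards [hev, hBo.mem_nhds hpB] with z hz hzB _ using (hh0 z hzB).1 hz
  obtain ⟨q, hq, hq0, g, hg, hgz, hgd⟩ :=
    hhana.exists_fderiv_ne_zero_of_zeros hpB ((hh0 p hpB).2 hp0) hnloc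
  obtain ⟨k, x, hk, hkx, -, hgk, V, hV, hkV⟩ := (hg q hq).exists_straightening hgd
  set lam := fderiv ℂ g q
  obtain ⟨e, he⟩ : ∃ e, lam e = 1 := by
    obtain ⟨y, hy⟩ := DFunLike.ne_iff.1 hgd
    exact ⟨(lam y)⁻¹ • y, by simpa using inv_mul_cancel₀ hy⟩
  have hlx : lam x = 0 := by
    rw [← hgk.self_of_nhds, hkx, hgz q hq hq0]
  have hkB : ∀ᶠ z in 𝓝 x, k z ∈ B :=
    hk.continuousAt.eventually (by rw [hkx]; exact hBo.mem_nhds hq)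
  have hhk : AnalyticAt ℂ (fun z => h (k z)) x :=
    AnalyticAt.comp (g := h) (by rw [hkx]; exact hhana q hq) hk
  have hfk : AnalyticAt ℂ (fun z => f (k z)) x :=
    AnalyticAt.comp (g := f) (by rw [hkx]; exact hfB q hq) hk
  have hvan := hhk.eventually_eq_zero_of_zeros_subset_ker he hlx (by rw [hkx, hq0]) (by
    filter_upwards [hkB, hgk] with z hzB hz hz0
    rw [← hz, hgz _ hzB hz0])
  -- Here dimension at least two is essential: on a line the kernel would be zero.
  obtain ⟨w, hw, hw0⟩ : ∃ w ∈ LinearMap.ker (lam : E →ₗ[ℂ] ℂ), w ≠ 0 :=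
    Submodule.exists_mem_ne_zero_of_ne_bot
      (LinearMap.ker_ne_bot_of_finrank_lt (by rw [Module.finrank_self]; omega))
  refine hfk.not_injOn_of_fderiv_eq_zero hlx hw0 hw ?_ (inter_mem hV hkB)
    fun y hy z hz hyz => hkV hy.1 hz.1 (hinjB hy.2 hz.2 hyz)
  filter_upwards [hvan, hkB, hk.eventually_analyticAt] with z hz hzB hkz hz0
  have := ((hfB _ hzB).differentiableAt.hasFDerivAt.comp z
    hkz.differentiableAt.hasFDerivAt).fderiv
  rw [(hh0 _ hzB).1 (hz hz0), ContinuousLinearMap.zero_comp] at this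
  exact this

end

/-- **Osgood's theorem**: the derivative of an injective analytic map between complex spaces of the
same finite dimension is injective. -/
theorem AnalyticAt.injective_fderiv_of_injOn (d : ℕ) (E : Type u) [NormedAddCommGroup E]
    [NormedSpace ℂ E] (F : Type v) [NormedAddCommGroup F] [NormedSpace ℂ F]
    [FiniteDimensional ℂ E] [FiniteDimensional ℂ F] (hE : Module.finrank ℂ E = d)
    (hF : Module.finrank ℂ F = d) (f : E → F) (p : E) (hf : AnalyticAt ℂ f p) (U : Set E)
    (hU : U ∈ 𝓝 p) (hinj : InjOn f U) : Function.Injective (fderiv ℂ f p) := by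
  -- Arbitrary spaces `E` and `F` are needed because the inductive step passes to kernels of
  -- functionals.
  induction d generalizing E F with
  | zero =>
    have := Module.finrank_zero_iff.1 hE
    exact Function.injective_of_subsingleton _
  | succ d ih =>
    by_cases hd : d = 0
    · subst hd
      exact hf.injective_fderiv_of_finrank_eq_one hE hF hU hinj
    · have hstep : ∀ᶠ z in 𝓝 p, fderiv ℂ f z ≠ 0 → Function.Injective (fderiv ℂ f z) := by
        filter_upwards [hf.eventually_analyticAt, eventually_mem_nhds_iff.2 hU] with z hz hzU hne
        exact hz.injective_fderiv_of_ne_zero ih hE hF hzU hinj hne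
      exact hstep.self_of_nhds
        (hf.fderiv_ne_zero_of_injOn (by omega) (hE.trans hF.symm) hU hinj hstep)

section

variable {n : ℕ}

/-- An injective analytic map has an analytic local inverse. -/
theorem AnalyticAt.exists_localInverse_of_injOn
    {f : EuclideanSpace ℂ (Fin n) → EuclideanSpace ℂ (Fin n)}
    {p : EuclideanSpace ℂ (Fin n)} (hf : AnalyticAt ℂ f p) {U : Set (EuclideanSpace ℂ (Fin n))}
    (hU : U ∈ 𝓝 p) (hinj : InjOn f U) :
    ∃ k : EuclideanSpace ℂ (Fin n) → EuclideanSpace ℂ (Fin n),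
      AnalyticAt ℂ k (f p) ∧ k (f p) = p ∧ ∀ᶠ y in 𝓝 (f p), f (k y) = y := by
  have hi := hf.injective_fderiv_of_injOn n _ _ (by simp) (by simp) f p U hU hinj
  let a : EuclideanSpace ℂ (Fin n) ≃L[ℂ] EuclideanSpace ℂ (Fin n) :=
    (LinearEquiv.ofInjectiveEndo (fderiv ℂ f p).toLinearMap hi).toContinuousLinearEquiv
  have ha : HasFDerivAt f (a : EuclideanSpace ℂ (Fin n) →L[ℂ] EuclideanSpace ℂ (Fin n)) p :=
    hf.differentiableAt.hasFDerivAt.congr_fderiv (by ext; simp [a])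
  obtain ⟨k, hk, hkp, -, hkr⟩ := hf.exists_localInverse a ha
  exact ⟨k, hk, hkp, hkr⟩

end

/-! ### Points of the quotient and identifications made by chains -/

theorem EvolutionQuotient.exists_chain_eq {M : Type u} {φ : ℝ≥0 → ℝ≥0 → M → M}
    (q : EvolutionQuotient φ) :
    ∃ t z, EvolutionQuotient.chain φ t z = q := by
  obtain ⟨⟨z, t⟩, h⟩ := Quotient.exists_rep q
  exact ⟨t, z, h⟩

theorem EvolutionQuotient.chainRange_chain {M : Type u} (φ : ℝ≥0 → ℝ≥0 → M → M) :
    chainRange (EvolutionQuotient.chain φ) = univ :=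
  eq_univ_of_forall fun q => by
    obtain ⟨t, z, rfl⟩ := EvolutionQuotient.exists_chain_eq q
    exact mem_chainRange _ t z

/-- Points identified by an injective associated chain are identified by every associated chain. -/
theorem IsAssociated.eq_of_eq {M : Type u} {N : Type v} {Q : Type w}
    {φ : ℝ≥0 → ℝ≥0 → M → M} {f : ℝ≥0 → M → N}
    {g : ℝ≥0 → M → Q} (hf : IsAssociated f φ) (hinj : ∀ t, Function.Injective (f t))
    (hg : IsAssociated g φ) {s t : ℝ≥0} {x y : M} (h : f s x = f t y) : g s x = g t y := by
  have hs := le_max_left s t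
  have ht := le_max_right s t
  rw [hf s _ hs, hf t _ ht] at h
  rw [hg s _ hs, hg t _ ht, Function.comp_apply, Function.comp_apply, hinj _ h]

/-! ### Univalent maps between manifolds -/

section

variable {n : ℕ} {M : Type u} {N : Type v}
  [TopologicalSpace M] [ChartedSpace (EuclideanSpace ℂ (Fin n)) M]
  [TopologicalSpace N] [ChartedSpace (EuclideanSpace ℂ (Fin n)) N]

/-- A univalent map between manifolds of the same dimension has holomorphic local inverses. -/
theorem IsUnivalent.exists_localInverse [IsManifold 𝓘(ℂ, EuclideanSpace ℂ (Fin n)) ω M]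
    [IsManifold 𝓘(ℂ, EuclideanSpace ℂ (Fin n)) ω N] {f : M → N}
    (hf : IsUnivalent n f) (x : M) :
    ∃ k : N → M,
      ContMDiffAt 𝓘(ℂ, EuclideanSpace ℂ (Fin n)) 𝓘(ℂ, EuclideanSpace ℂ (Fin n)) ω k (f x) ∧
      k (f x) = x ∧ ∀ᶠ y in 𝓝 (f x), f (k y) = y := by
  set c := chartAt (EuclideanSpace ℂ (Fin n)) x
  set e := chartAt (EuclideanSpace ℂ (Fin n)) (f x)
  have hx : x ∈ c.source := mem_chart_source _ x
  have hfx : f x ∈ e.source := mem_chart_source _ (f x)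
  obtain ⟨hcont, hsm⟩ := contMDiffAt_iff.1 (hf.1 x)
  have hana : AnalyticAt ℂ (fun z => e (f (c.symm z))) (c x) := by
    have : ContDiffAt ℂ ω (fun z => e (f (c.symm z))) (c x) := by
      simpa [Function.comp_def, contDiffWithinAt_univ] using hsm
    exact this.analyticAt
  have hcx : c.symm (c x) = x := c.left_inv hx
  have hcs : ContinuousAt c.symm (c x) := c.continuousAt_symm (c.map_source hx)
  have hU : ∀ᶠ z in 𝓝 (c x), z ∈ c.target ∧ f (c.symm z) ∈ e.source :=
    (c.open_target.eventually_mem (c.map_source hx)).and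
      ((ContinuousAt.comp (g := f) (by rwa [hcx]) hcs).eventually
        (by simpa [hcx] using e.open_source.mem_nhds hfx))
  obtain ⟨k, hk, hkx, hright⟩ := hana.exists_localInverse_of_injOn hU (by
    rintro z ⟨hz, hz'⟩ y ⟨hy, hy'⟩ hzy
    exact c.symm.injOn hz hy (hf.2 (e.injOn hz' hy' hzy)))
  rw [hcx] at hk hkx hright
  have hec : ContinuousAt e (f x) := e.continuousAt hfx
  refine ⟨fun y => c.symm (k (e y)), ?_, by simp [hkx, hcx], ?_⟩
  · have h1 : ContMDiffAt 𝓘(ℂ, EuclideanSpace ℂ (Fin n)) 𝓘(ℂ, EuclideanSpace ℂ (Fin n)) ω e (f x) :=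
      contMDiffAt_of_mem_maximalAtlas (IsManifold.chart_mem_maximalAtlas (f x)) hfx
    have h2 : ContMDiffAt 𝓘(ℂ, EuclideanSpace ℂ (Fin n)) 𝓘(ℂ, EuclideanSpace ℂ (Fin n)) ω k
        (e (f x)) :=
      hk.contDiffAt.contMDiffAt
    have h3 : ContMDiffAt 𝓘(ℂ, EuclideanSpace ℂ (Fin n)) 𝓘(ℂ, EuclideanSpace ℂ (Fin n)) ω c.symm
        (k (e (f x))) := by
      rw [hkx]
      exact contMDiffAt_symm_of_mem_maximalAtlas (IsManifold.chart_mem_maximalAtlas x)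
        (c.map_source hx)
    exact h3.comp (f x) (h2.comp (f x) h1)
  · have hkc : ContinuousAt (fun y => k (e y)) (f x) :=
      ContinuousAt.comp (g := k) hk.continuousAt hec
    rw [← hkx] at hU
    filter_upwards [hkc.eventually hU, hec.eventually hright,
      e.open_source.mem_nhds hfx] with y hy1 hy2 hy3
    exact e.injOn hy1.2 hy3 hy2

/-- A univalent map between manifolds of the same dimension is open. -/
theorem IsUnivalent.isOpenMap [IsManifold 𝓘(ℂ, EuclideanSpace ℂ (Fin n)) ω M]
    [IsManifold 𝓘(ℂ, EuclideanSpace ℂ (Fin n)) ω N] {f : M → N}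
    (hf : IsUnivalent n f) : IsOpenMap f := by
  refine isOpenMap_iff_nhds_le.2 fun x s hs => ?_
  obtain ⟨k, hk, hkx, hright⟩ := hf.exists_localInverse x
  have := hk.continuousAt.eventually (by rw [hkx]; exact hs)
  filter_upwards [this, hright] with y hy hy'
  rwa [hy'] at hy

/-! ### The equivalence relation and the topology of the quotient -/

namespace IsAlgebraicEvolutionFamily

variable {φ : ℝ≥0 → ℝ≥0 → M → M}

theorem comp_apply (hφ : IsAlgebraicEvolutionFamily n φ) {s u t : ℝ≥0} (hsu : s ≤ u) (hut : u ≤ t)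
    (x : M) : φ u t (φ s u x) = φ s t x :=
  (congrFun (hφ.comp s u t hsu hut) x).symm

/-- An equality at time `u` propagates forward by composition, and one at a later time `r` pulls
back to `u` because `φ u r` is injective. -/
theorem chain_eq_iff (hφ : IsAlgebraicEvolutionFamily n φ) {s t u : ℝ≥0} (hs : s ≤ u) (ht : t ≤ u)
    {x y : M} : EvolutionQuotient.chain φ s x = EvolutionQuotient.chain φ t y ↔
      φ s u x = φ t u y := by
  refine Quotient.eq.trans ⟨fun h => ?_, fun h => ?_⟩
  · obtain ⟨r, hr, hur⟩ := (h.and (eventually_ge_atTop u)).exists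
    refine (hφ.univalent u r hur).2 ?_
    rw [hφ.comp_apply hs hur, hφ.comp_apply ht hur]
    exact hr
  · refine (eventually_ge_atTop u).mono fun r hr => ?_
    rw [← hφ.comp_apply hs hr, ← hφ.comp_apply ht hr, h]

theorem chain_injective (hφ : IsAlgebraicEvolutionFamily n φ) (t : ℝ≥0) :
    Function.Injective (EvolutionQuotient.chain φ t) := fun x y h => by
  simpa [hφ.refl] using (hφ.chain_eq_iff le_rfl le_rfl).1 h

theorem isAssociated_chain (hφ : IsAlgebraicEvolutionFamily n φ) :
    IsAssociated (EvolutionQuotient.chain φ) φ := fun s t hst => by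
  funext x
  refine (hφ.chain_eq_iff hst le_rfl).2 ?_
  simp [hφ.refl]

end IsAlgebraicEvolutionFamily

/-- With discrete time, the product is a disjoint union of copies of `M`. The discrete topology must
locally replace the usual one on `ℝ≥0`. -/
theorem EvolutionQuotient.isOpen_iff {φ : ℝ≥0 → ℝ≥0 → M → M} {s : Set (EvolutionQuotient φ)} :
    IsOpen s ↔ ∀ t, IsOpen (EvolutionQuotient.chain φ t ⁻¹' s) := by
  let : TopologicalSpace ℝ≥0 := ⊥
  have : DiscreteTopology ℝ≥0 := ⟨rfl⟩
  refine Iff.trans (isOpen_coinduced (f := Quotient.mk (evolutionSetoid φ))) ?_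
  constructor
  · intro h t
    exact h.preimage (f := fun z : M => (z, t)) (Continuous.prodMk_left t)
  · intro h
    refine isOpen_iff_mem_nhds.2 fun ⟨z, t⟩ hz => ?_
    rw [nhds_prod_eq, nhds_discrete ℝ≥0, Filter.prod_pure, Filter.mem_map]
    exact (h t).mem_nhds hz

theorem EvolutionQuotient.continuous_chain (φ : ℝ≥0 → ℝ≥0 → M → M) (t : ℝ≥0) :
    Continuous (EvolutionQuotient.chain φ t) :=
  ⟨fun _ hs => EvolutionQuotient.isOpen_iff.1 hs t⟩

namespace IsAlgebraicEvolutionFamily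

variable {φ : ℝ≥0 → ℝ≥0 → M → M}

theorem connectedSpace_quotient [ConnectedSpace M] (hφ : IsAlgebraicEvolutionFamily n φ) :
    ConnectedSpace (EvolutionQuotient φ) := by
  obtain ⟨z⟩ := ‹ConnectedSpace M›.toNonempty
  have hpre : IsPreconnected (⋃ t, range (EvolutionQuotient.chain φ t)) :=
    isPreconnected_iUnion ⟨EvolutionQuotient.chain φ 0 z, mem_iInter.2 fun t =>
      ⟨φ 0 t z, (congrFun (hφ.isAssociated_chain 0 t zero_le) z).symm⟩⟩
      fun t => isPreconnected_range (EvolutionQuotient.continuous_chain φ t)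
  exact { isPreconnected_univ := EvolutionQuotient.chainRange_chain φ ▸ hpre
          toNonempty := ⟨EvolutionQuotient.chain φ 0 z⟩ }

variable [IsManifold 𝓘(ℂ, EuclideanSpace ℂ (Fin n)) ω M]

/-- Osgood's theorem enters here: seen from copy `r`, the image of an open set of copy `t` is
computed at time `max t r`, where `φ t (max t r)` is open. -/
theorem isOpenEmbedding_chain (hφ : IsAlgebraicEvolutionFamily n φ) (t : ℝ≥0) :
    IsOpenEmbedding (EvolutionQuotient.chain φ t) := by
  refine .of_continuous_injective_isOpenMap (EvolutionQuotient.continuous_chain φ t)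
    (hφ.chain_injective t) fun s hs => EvolutionQuotient.isOpen_iff.2 fun r => ?_
  have : EvolutionQuotient.chain φ r ⁻¹' (EvolutionQuotient.chain φ t '' s) =
      φ r (max t r) ⁻¹' (φ t (max t r) '' s) := by
    ext y
    simp only [mem_preimage, mem_image,
      hφ.chain_eq_iff (le_max_left t r) (le_max_right t r)]
  rw [this]
  exact ((hφ.univalent t _ (le_max_left t r)).isOpenMap s hs).preimage
    (hφ.univalent r _ (le_max_right t r)).1.continuous

theorem t2Space_quotient [T2Space M] (hφ : IsAlgebraicEvolutionFamily n φ) :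
    T2Space (EvolutionQuotient φ) := by
  refine ⟨fun p q hpq => ?_⟩
  obtain ⟨s, x, rfl⟩ := EvolutionQuotient.exists_chain_eq p
  obtain ⟨t, y, rfl⟩ := EvolutionQuotient.exists_chain_eq q
  have hx := congrFun (hφ.isAssociated_chain s _ (le_max_left s t)) x
  have hy := congrFun (hφ.isAssociated_chain t _ (le_max_right s t)) y
  simp only [Function.comp_apply] at hx hy
  rw [hx, hy] at hpq ⊢
  obtain ⟨U, V, hU, hV, hxU, hyV, hd⟩ := t2_separation (ne_of_apply_ne _ hpq)
  have ho := hφ.isOpenEmbedding_chain (max s t)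
  exact ⟨_, _, ho.isOpenMap U hU, ho.isOpenMap V hV, ⟨_, hxU, rfl⟩, ⟨_, hyV, rfl⟩,
    (disjoint_image_iff ho.injective).2 hd⟩

/-- The copies increase with time, so those at integer times form a countable open cover. -/
theorem secondCountableTopology_quotient [SecondCountableTopology M]
    (hφ : IsAlgebraicEvolutionFamily n φ) : SecondCountableTopology (EvolutionQuotient φ) := by
  have hsc : ∀ m : ℕ, SecondCountableTopology (range (EvolutionQuotient.chain φ (m : ℝ≥0))) :=
    fun m => (hφ.isOpenEmbedding_chain m).isEmbedding.toHomeomorph.symm.secondCountableTopology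
  refine TopologicalSpace.secondCountableTopology_of_countable_cover
    (U := fun m : ℕ => range (EvolutionQuotient.chain φ (m : ℝ≥0)))
    (fun m => (hφ.isOpenEmbedding_chain m).isOpen_range) ?_
  refine eq_univ_of_forall fun q => ?_
  obtain ⟨s, x, rfl⟩ := EvolutionQuotient.exists_chain_eq q
  obtain ⟨m, hm⟩ := exists_nat_ge s
  exact mem_iUnion.2 ⟨m, φ s m x, (congrFun (hφ.isAssociated_chain s m hm) x).symm⟩

/-! ### The complex structure of the quotient -/

/-- The chart of the quotient obtained by transporting a chart of `M` to the `t`-th copy of `M`. -/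
noncomputable def quotientChart (hφ : IsAlgebraicEvolutionFamily n φ) (t : ℝ≥0) (z : M) :
    OpenPartialHomeomorph (EvolutionQuotient φ) (EuclideanSpace ℂ (Fin n)) :=
  haveI : Nonempty M := ⟨z⟩
  ((hφ.isOpenEmbedding_chain t).toOpenPartialHomeomorph _).symm.trans
    (chartAt (EuclideanSpace ℂ (Fin n)) z)

theorem mem_quotientChart_source (hφ : IsAlgebraicEvolutionFamily n φ) (t : ℝ≥0) (z : M) :
    EvolutionQuotient.chain φ t z ∈ (hφ.quotientChart t z).source := by
  have : Nonempty M := ⟨z⟩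
  simp [quotientChart, IsOpenEmbedding.toOpenPartialHomeomorph_left_inv]

theorem quotientChart_symm_apply (hφ : IsAlgebraicEvolutionFamily n φ) (t : ℝ≥0) (z : M)
    (x : EuclideanSpace ℂ (Fin n)) : (hφ.quotientChart t z).symm x =
      EvolutionQuotient.chain φ t ((chartAt (EuclideanSpace ℂ (Fin n)) z).symm x) := by
  simp [quotientChart]

/-- The atlas on the quotient made of the charts of all copies of `M`. -/
@[reducible]
noncomputable def quotientChartedSpace (hφ : IsAlgebraicEvolutionFamily n φ) :
    ChartedSpace (EuclideanSpace ℂ (Fin n)) (EvolutionQuotient φ) where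
  atlas := {e | ∃ t z, e = hφ.quotientChart t z}
  chartAt q := hφ.quotientChart (Quotient.out q).2 (Quotient.out q).1
  mem_chart_source q := by
    have h := hφ.mem_quotientChart_source (Quotient.out q).2 (Quotient.out q).1
    rwa [show EvolutionQuotient.chain φ (Quotient.out q).2 (Quotient.out q).1 = q from
      Quotient.out_eq q] at h
  chart_mem_atlas q := ⟨_, _, rfl⟩

/-- The transition from one copy of `M` to another is holomorphic. -/
theorem contMDiffAt_transition (hφ : IsAlgebraicEvolutionFamily n φ) (s t : ℝ≥0) {y : M}
    {ψ : EvolutionQuotient φ → M}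
    (hψ : ∀ q ∈ range (EvolutionQuotient.chain φ t), EvolutionQuotient.chain φ t (ψ q) = q)
    (hy : EvolutionQuotient.chain φ s y ∈ range (EvolutionQuotient.chain φ t)) :
    ContMDiffAt 𝓘(ℂ, EuclideanSpace ℂ (Fin n)) 𝓘(ℂ, EuclideanSpace ℂ (Fin n)) ω
      (fun x => ψ (EvolutionQuotient.chain φ s x)) y := by
  have hs := le_max_left s t
  have ht := le_max_right s t
  have heq : ∀ x, EvolutionQuotient.chain φ s x ∈ range (EvolutionQuotient.chain φ t) →
      φ t (max s t) (ψ (EvolutionQuotient.chain φ s x)) = φ s (max s t) x := fun x hx =>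
    (hφ.chain_eq_iff ht hs).1 (hψ _ hx)
  have hu := hφ.univalent t _ ht
  obtain ⟨k, hk, -, hright⟩ := hu.exists_localInverse (ψ (EvolutionQuotient.chain φ s y))
  rw [heq y hy] at hk hright
  have hus := (hφ.univalent s _ hs).1 y
  -- By `heq`, the transition is locally `k ∘ φ s (max s t)`, with `k` a local inverse of `φ t (max
  -- s t)`.
  refine (hk.comp y hus).congr_of_eventuallyEq ?_
  filter_upwards [hus.continuousAt.eventually hright,
    ((hφ.isOpenEmbedding_chain t).isOpen_range.preimage
      (EvolutionQuotient.continuous_chain φ s)).mem_nhds hy] with x hx hxr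
  refine hu.2 ?_
  rw [heq x hxr, Function.comp_apply, hx]

theorem isManifold_quotient (hφ : IsAlgebraicEvolutionFamily n φ) :
    letI := hφ.quotientChartedSpace
    IsManifold 𝓘(ℂ, EuclideanSpace ℂ (Fin n)) ω (EvolutionQuotient φ) := by
  let := hφ.quotientChartedSpace
  refine isManifold_of_contDiffOn _ _ _ ?_
  rintro _ _ ⟨s, z, rfl⟩ ⟨t, w, rfl⟩ x hx
  have : Nonempty M := ⟨z⟩
  have hI : x ∈ ((hφ.quotientChart s z).symm.trans (hφ.quotientChart t w)).source := by
    simpa using hx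
  simp only [OpenPartialHomeomorph.trans_source, mem_inter_iff, mem_preimage,
    hφ.quotientChart_symm_apply, OpenPartialHomeomorph.symm_source] at hI
  obtain ⟨hx1, hx2⟩ := hI
  have hxc : x ∈ (chartAt (EuclideanSpace ℂ (Fin n)) z).target := by
    simp only [quotientChart, OpenPartialHomeomorph.trans_target] at hx1
    exact hx1.1
  simp only [quotientChart, OpenPartialHomeomorph.trans_source, mem_inter_iff, mem_preimage,
    OpenPartialHomeomorph.symm_source, IsOpenEmbedding.toOpenPartialHomeomorph_target] at hx2
  have h1 := contMDiffAt_symm_of_mem_maximalAtlas (I := 𝓘(ℂ, EuclideanSpace ℂ (Fin n))) (n := ω)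
    (IsManifold.chart_mem_maximalAtlas z) hxc
  have h2 := hφ.contMDiffAt_transition s t (y := (chartAt (EuclideanSpace ℂ (Fin n)) z).symm x)
    (fun q hq => (hφ.isOpenEmbedding_chain t).toOpenPartialHomeomorph_right_inv _ hq) hx2.1
  have h3 := contMDiffAt_of_mem_maximalAtlas (I := 𝓘(ℂ, EuclideanSpace ℂ (Fin n))) (n := ω)
    (IsManifold.chart_mem_maximalAtlas w) hx2.2
  have h4 := (h3.comp x (h2.comp x h1)).contDiffAt
  refine ContDiffAt.contDiffWithinAt ?_
  simpa [quotientChart, Function.comp_def] using h4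

/-- In the chart of `M` at `z` and its transport to copy `t`, the map is the identity. -/
theorem isHolomorphic_chain (hφ : IsAlgebraicEvolutionFamily n φ) (t : ℝ≥0) :
    letI := hφ.quotientChartedSpace
    IsHolomorphic n (EvolutionQuotient.chain φ t) := by
  let := hφ.quotientChartedSpace
  have := hφ.isManifold_quotient
  intro z
  have hz := mem_chart_source (EuclideanSpace ℂ (Fin n)) z
  have h1 := contMDiffAt_of_mem_maximalAtlas (I := 𝓘(ℂ, EuclideanSpace ℂ (Fin n))) (n := ω)
    (IsManifold.chart_mem_maximalAtlas z) hz
  have hmem : hφ.quotientChart t z ∈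
      IsManifold.maximalAtlas 𝓘(ℂ, EuclideanSpace ℂ (Fin n)) ω (EvolutionQuotient φ) :=
    IsManifold.subset_maximalAtlas ⟨t, z, rfl⟩
  have h2 := contMDiffAt_symm_of_mem_maximalAtlas hmem
    (x := chartAt (EuclideanSpace ℂ (Fin n)) z z) (by
      have : Nonempty M := ⟨z⟩
      simp [quotientChart, hz])
  refine (h2.comp z h1).congr_of_eventuallyEq ?_
  filter_upwards [(chartAt (EuclideanSpace ℂ (Fin n)) z).open_source.mem_nhds hz] with x hx
  simp [quotientChart_symm_apply, OpenPartialHomeomorph.left_inv _ hx]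

theorem isAlgebraicLoewnerChain_chain (hφ : IsAlgebraicEvolutionFamily n φ) :
    letI := hφ.quotientChartedSpace
    IsAlgebraicLoewnerChain n (EvolutionQuotient.chain φ) :=
  letI := hφ.quotientChartedSpace
  { holomorphic := hφ.isHolomorphic_chain
    subordinate := fun s t hst =>
      ⟨φ s t, (hφ.univalent s t hst).1, hφ.isAssociated_chain s t hst⟩
    univalent := fun t => ⟨hφ.isHolomorphic_chain t, hφ.chain_injective t⟩ }

end IsAlgebraicEvolutionFamily

/-! ### The universal property -/

theorem IsAlgebraicLoewnerChain.isOpen_chainRange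
    [IsManifold 𝓘(ℂ, EuclideanSpace ℂ (Fin n)) ω M]
    [IsManifold 𝓘(ℂ, EuclideanSpace ℂ (Fin n)) ω N] {f : ℝ≥0 → M → N}
    (hf : IsAlgebraicLoewnerChain n f) : IsOpen (chainRange f) :=
  isOpen_iUnion fun t => (hf.univalent t).isOpenMap.isOpen_range

/-- An algebraic Loewner chain is universal among the subordination chains associated with the same
evolution family. -/
theorem exists_universal_map {Q : Type w} [TopologicalSpace Q]
    [ChartedSpace (EuclideanSpace ℂ (Fin n)) Q] [IsManifold 𝓘(ℂ, EuclideanSpace ℂ (Fin n)) ω M]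
    [IsManifold 𝓘(ℂ, EuclideanSpace ℂ (Fin n)) ω N] {φ : ℝ≥0 → ℝ≥0 → M → M}
    {f : ℝ≥0 → M → N} {g : ℝ≥0 → M → Q}
    (hf : IsAlgebraicLoewnerChain n f) (hfφ : IsAssociated f φ) (ho : IsOpen (chainRange f))
    (hg : IsSubordinationChain n g) (hgφ : IsAssociated g φ) :
    ∃ Λ : (⟨chainRange f, ho⟩ : TopologicalSpace.Opens N) → Q,
      IsHolomorphic n Λ ∧
      (∀ t z, g t z = Λ ⟨f t z, mem_chainRange f t z⟩) ∧
      (IsUnivalent n Λ ↔ IsAlgebraicLoewnerChain n g) ∧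
      (IsAlgebraicLoewnerChain n g → chainRange g = range Λ) := by
  have hex : ∀ y : (⟨chainRange f, ho⟩ : TopologicalSpace.Opens N), ∃ t z, f t z = y :=
    fun y => by simpa [chainRange] using y.2
  choose τ ζ hτζ using hex
  let Λ : (⟨chainRange f, ho⟩ : TopologicalSpace.Opens N) → Q := fun y => g (τ y) (ζ y)
  have hfinj : ∀ t, Function.Injective (f t) := fun t => (hf.univalent t).2
  have hΛ : ∀ t z, g t z = Λ ⟨f t z, mem_chainRange f t z⟩ := fun t z =>
    hfφ.eq_of_eq hfinj hgφ (hτζ ⟨f t z, mem_chainRange f t z⟩).symm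
  have hhol : IsHolomorphic n Λ := by
    intro y
    obtain ⟨k, hk, -, hright⟩ := (hf.univalent (τ y)).exists_localInverse (ζ y)
    rw [hτζ y] at hk hright
    have hval : ContMDiffAt 𝓘(ℂ, EuclideanSpace ℂ (Fin n)) 𝓘(ℂ, EuclideanSpace ℂ (Fin n)) ω
        (Subtype.val : (⟨chainRange f, ho⟩ : TopologicalSpace.Opens N) → N) y :=
      contMDiff_subtype_val y
    refine (((hg.holomorphic (τ y)) (k y)).comp y (hk.comp y hval)).congr_of_eventuallyEq ?_
    -- Although `τ x` varies with `x`, the value of `Λ` does not depend on the representative, so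
    -- the fixed time `τ y` can be used near `y`.
    filter_upwards [hval.continuousAt.eventually hright] with x hx
    exact hfφ.eq_of_eq hfinj hgφ ((hτζ x).trans hx.symm)
  refine ⟨Λ, hhol, hΛ, ⟨fun hu => ⟨hg, fun t => ⟨hg.holomorphic t, fun x y hxy => ?_⟩⟩,
    fun hl => ⟨hhol, fun x y hxy => ?_⟩⟩, fun _ => ?_⟩
  · rw [hΛ, hΛ] at hxy
    exact hfinj t (congrArg Subtype.val (hu.2 hxy))
  · refine Subtype.ext ?_
    rw [← hτζ x, ← hτζ y]
    -- The same identification principle with `f` and `g` exchanged.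
    exact hgφ.eq_of_eq (fun t => (hl.univalent t).2) hfφ hxy
  · refine Subset.antisymm (iUnion_subset fun t => ?_) ?_
    · rintro _ ⟨z, rfl⟩
      exact ⟨_, (hΛ t z).symm⟩
    · rintro _ ⟨y, rfl⟩
      exact mem_chainRange g (τ y) (ζ y)

end

end OsgoodAndQuotient

theorem theorem7p3 (n : ℕ) {M : Type u} [TopologicalSpace M]
    [ChartedSpace (EuclideanSpace ℂ (Fin n)) M]
    [IsManifold 𝓘(ℂ, EuclideanSpace ℂ (Fin n)) ω M] [T2Space M] [SecondCountableTopology M]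
    (φ : ℝ≥0 → ℝ≥0 → M → M) (hφ : IsAlgebraicEvolutionFamily n φ) :
    -- the quotient of `M × ℝ⁺` is a complex manifold, and the canonical maps into it form an
    -- associated algebraic Loewner chain whose range is the whole quotient
    (∃ _ : ChartedSpace (EuclideanSpace ℂ (Fin n)) (EvolutionQuotient φ),
      IsManifold 𝓘(ℂ, EuclideanSpace ℂ (Fin n)) ω (EvolutionQuotient φ) ∧
      T2Space (EvolutionQuotient φ) ∧
      SecondCountableTopology (EvolutionQuotient φ) ∧
      (ConnectedSpace M → ConnectedSpace (EvolutionQuotient φ)) ∧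
      IsAlgebraicLoewnerChain n (EvolutionQuotient.chain φ) ∧
      IsAssociated (EvolutionQuotient.chain φ) φ ∧
      chainRange (EvolutionQuotient.chain φ) = Set.univ) ∧
    -- every associated algebraic Loewner chain is universal among associated subordination chains
    (∀ (N : Type v) [TopologicalSpace N] [ChartedSpace (EuclideanSpace ℂ (Fin n)) N]
      [IsManifold 𝓘(ℂ, EuclideanSpace ℂ (Fin n)) ω N] [T2Space N] [SecondCountableTopology N]
      (f : ℝ≥0 → M → N), IsAlgebraicLoewnerChain n f → IsAssociated f φ →
      ∃ hf : IsOpen (chainRange f),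
        ∀ (Q : Type w) [TopologicalSpace Q] [ChartedSpace (EuclideanSpace ℂ (Fin n)) Q]
          [IsManifold 𝓘(ℂ, EuclideanSpace ℂ (Fin n)) ω Q] [T2Space Q] [SecondCountableTopology Q]
          (g : ℝ≥0 → M → Q), IsSubordinationChain n g → IsAssociated g φ →
          ∃ Λ : (⟨chainRange f, hf⟩ : TopologicalSpace.Opens N) → Q,
            IsHolomorphic n Λ ∧
            (∀ t z, g t z = Λ ⟨f t z, mem_chainRange f t z⟩) ∧
            (IsUnivalent n Λ ↔ IsAlgebraicLoewnerChain n g) ∧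
            (IsAlgebraicLoewnerChain n g → chainRange g = Set.range Λ)) :=
  ⟨⟨hφ.quotientChartedSpace, hφ.isManifold_quotient, hφ.t2Space_quotient,
    hφ.secondCountableTopology_quotient, fun _ => hφ.connectedSpace_quotient,
    hφ.isAlgebraicLoewnerChain_chain, hφ.isAssociated_chain,
    EvolutionQuotient.chainRange_chain φ⟩,
    fun _ _ _ _ _ _ _ hf hfφ => ⟨hf.isOpen_chainRange, fun _ _ _ _ _ _ _ hg hgφ =>
      exists_universal_map hf hfφ _ hg hgφ⟩⟩
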